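/- Let $G=(V,E)$ be a finite undirected graph (parallel edges and loops are allowed), let $\mathbf{R}=\{r_1,\dots,r_t\}$ be a finite multiset of vertices of $G$ (the roots), and let $\mathcal{M}$ be a matroid on $\mathbf{R}$ (whose elements $r_1,\dots,r_t$ are regarded as distinct, even when they are copies of the same vertex) with rank function $r_{\mathcal{M}}$ and rank $k=r_{\mathcal{M}}(\mathbf{R})$. For $F\subseteq E$ let $V(F)$ be the set of vertices incident to an edge of $F$, and put $\mathbf{R}_F=\{r_i\in\mathbf{R}\mid r_i\in V(F)\}$; for $v\in V$ put $\mathbf{R}_v=\{r_i\in\mathbf{R}\mid r_i=v\}$ (both as multi-subsets of $\mathbf{R}$). A pair $(T,r)$ of $T\subseteq E$ and $r\in V$ is called a rooted tree if either $T=\emptyset$, or $T$ is connected without cycles and $r\in V(T)$; it spans the vertices in $V(T)\cup\{r\}$. Then the edge set $E$ can be partitioned into pairwise disjoint (possibly empty) sets $T_1,\dots,T_t$ such that every $(T_i,r_i)$ is a rooted tree and, for each $v\in V$, the multiset $\{r_i\in\mathbf{R}\mid v\in V(T_i)\cup\{r_i\}\}$ is a base of $\mathcal{M}$, if and only if the following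 three conditions hold: (C1) $\mathbf{R}_v$ is independent in $\mathcal{M}$ for each $v\in V$; (C2) $|F|+|\mathbf{R}_F|\le k|V(F)|-k+r_{\mathcal{M}}(\mathbf{R}_F)$ for every nonempty $F\subseteq E$; (C3) $|E|+|\mathbf{R}|=k|V|$. -/

import Mathlib

open scoped Graph

namespace Graph

variable {α β ι : Type*}

/-- `V(F)`: the set of vertices incident to some edge of `F`. -/
def edgeVerts (G : Graph α β) (F : Set β) : Set α :=
  {v | ∃ e ∈ F, G.Inc e v}

/-- The edge set `F`, as the subgraph `(V(F), F)`, is connected: any two vertices of `V(F)` are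
joined by a walk all of whose edges are in `F`. -/
def EdgesConnected (G : Graph α β) (F : Set β) : Prop :=
  ∀ u ∈ G.edgeVerts F, ∀ v ∈ G.edgeVerts F,
    Relation.ReflTransGen (fun x y => ∃ e ∈ F, G.IsLink e x y) u v

/-- The vertices `v 0, …, v n` and the edges `e 0, …, e n` form a cycle of length `n + 1`: the
vertices are distinct, the edges are distinct, and `e i` joins `v i` to `v (i + 1)`, with indices
modulo `n + 1`. A loop is a cycle of length one, and two parallel edges form a cycle of length
two. -/
structure IsCyclicSeq (G : Graph α β) {n : ℕ} (v : Fin (n + 1) → α) (e : Fin (n + 1) → β) :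
    Prop where
  vert_injective : Function.Injective v
  edge_injective : Function.Injective e
  isLink : ∀ i, G.IsLink (e i) (v i) (v (i + 1))

/-- The edge set `F` contains no cycle. -/
def EdgesAcyclic (G : Graph α β) (F : Set β) : Prop :=
  ∀ (n : ℕ) (v : Fin (n + 1) → α) (e : Fin (n + 1) → β),
    G.IsCyclicSeq v e → ¬ (∀ i, e i ∈ F)

/-- `(T, r)` is a rooted tree of `G`: `T` is a set of edges, `r` is a vertex, and either `T` is
empty, or `T` is connected without cycles and `r ∈ V(T)`. -/
structure IsRootedTree (G : Graph α β) (T : Set β) (r : α) : Prop where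
  subset_edgeSet : T ⊆ E(G)
  root_mem : r ∈ V(G)
  tree : T = ∅ ∨ (G.EdgesConnected T ∧ G.EdgesAcyclic T ∧ r ∈ G.edgeVerts T)

/-- `V(T, r) = V(T) ∪ {r}`: the set of vertices spanned by the rooted tree `(T, r)`. -/
def spannedVerts (G : Graph α β) (T : Set β) (r : α) : Set α :=
  G.edgeVerts T ∪ {r}

/-- The rooted trees `(T i, root i)` form a basic rooted-tree decomposition of `G` with roots
`root` with respect to the matroid `M` on the (indices of the) roots. Empty trees are allowed. -/
structure IsBasicDecomposition (G : Graph α β) (root : ι → α) (M : Matroid ι)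
    (T : ι → Set β) : Prop where
  isRootedTree : ∀ i, G.IsRootedTree (T i) (root i)
  edge_disjoint : ∀ i j, i ≠ j → Disjoint (T i) (T j)
  iUnion_eq : ⋃ i, T i = E(G)
  basic : ∀ v ∈ V(G), M.IsBase {i | v ∈ G.spannedVerts (T i) (root i)}

end Graph

/-- The multi-subset of those roots that lie in the vertex set `X`, as a set of indices. -/
def rootsIn {α ι : Type*} (root : ι → α) (X : Set α) : Set ι :=
  {i | root i ∈ X}

/-- The rank function of a matroid, with natural-number values (for matroids on finite sets). -/
noncomputable def Matroid.natRk {ι : Type*} (M : Matroid ι) (X : Set ι) : ℕ :=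
  (M.eRk X).toNat

/-! Necessity is double counting. A tree spans one more vertex than it has edges, and each vertex
lies in exactly `k` spanned sets, which gives (C3). Counting only inside `V(F)`, each tree that
meets `V(F)` leaves a surplus of at least one. The roots of these trees include `R_F` and a base,
which gives (C2) (`sparse`).

For sufficiency, Hall's theorem orients the edges with in-degree at most `k - |R_v|` at `v`
(`exists_orientation_of_card_le`), and (C3) forces equality. By (C2), for every nonempty `X`, the
number of arcs entering `X` plus the rank of the roots in `X` is at least `k`. Under this cut
condition the trees grow arc by arc: `S v` is the set of trees containing `v`, and an arc may join
tree `s` if `S` stays independent and no tight cut is violated. Such an arc exists by uncrossing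
tight sets (`tight_inter`, `exists_admissible_arc`). Once no arc is left, the cut condition at
single vertices says that every `S v` is a base. -/

namespace Matroid

/-! ### Matroid rank and closure -/

variable {ι : Type*} {M : Matroid ι} {A B : Set ι} {x : ι}

theorem natRk_closure (M : Matroid ι) (A : Set ι) : M.natRk (M.closure A) = M.natRk A := by
  simp [natRk]

theorem Indep.natRk_eq_ncard (h : M.Indep A) : M.natRk A = A.ncard := by
  rw [natRk, h.eRk_eq_encard, Set.ncard_def]

theorem subset_closure_of_ground_eq_univ (hM : M.E = Set.univ) (A : Set ι) :
    A ⊆ M.closure A :=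
  M.subset_closure A (hM ▸ Set.subset_univ A)

theorem IsBase.natRk_eq (hM : M.E = Set.univ) (h : M.IsBase A) :
    M.natRk A = M.natRk Set.univ := by
  rw [natRk, natRk, h.eRk_eq_eRank, ← hM, eRk_ground]

variable [Finite ι]

theorem cast_natRk (M : Matroid ι) (X : Set ι) : (M.natRk X : ℕ∞) = M.eRk X :=
  ENat.natCast_toNat (M.isRkFinite_of_finite X.toFinite).eRk_lt_top.ne

theorem natRk_mono (M : Matroid ι) (h : A ⊆ B) : M.natRk A ≤ M.natRk B := by
  have := M.eRk_mono h
  simp only [← cast_natRk] at this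
  exact_mod_cast this

theorem natRk_submod (M : Matroid ι) (A B : Set ι) :
    M.natRk (A ∩ B) + M.natRk (A ∪ B) ≤ M.natRk A + M.natRk B := by
  have := M.eRk_submod A B
  simp only [← cast_natRk] at this
  exact_mod_cast this

theorem natRk_le_ncard (M : Matroid ι) (A : Set ι) : M.natRk A ≤ A.ncard := by
  have := M.eRk_le_encard A
  rw [← cast_natRk, ← A.toFinite.cast_ncard_eq] at this
  exact_mod_cast this

theorem natRk_insert (hM : M.E = Set.univ) (hx : x ∉ M.closure A) :
    M.natRk (insert x A) = M.natRk A + 1 := by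
  have := M.eRk_insert_eq_add_one (e := x) (X := A) ⟨hM ▸ Set.mem_univ x, hx⟩
  simp only [← cast_natRk] at this
  exact_mod_cast this

/-- For a modular pair, the closure of the intersection is the intersection of the closures. -/
theorem mem_closure_inter_of_modular (hM : M.E = Set.univ)
    (h : M.natRk A + M.natRk B ≤ M.natRk (A ∩ B) + M.natRk (A ∪ B))
    (hA : x ∈ M.closure A) (hB : x ∈ M.closure B) : x ∈ M.closure (A ∩ B) := by
  by_contra hx
  have h1 := natRk_insert hM hx
  have hcA := subset_closure_of_ground_eq_univ hM A
  have hcB := subset_closure_of_ground_eq_univ hM B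
  -- Submodularity for the two closures, together with modularity of the pair, bounds this rank by
  -- that of `A ∩ B`, which `h1` exceeds.
  have h2 : M.natRk (insert x (A ∩ B)) ≤ M.natRk (M.closure A ∩ M.closure B) :=
    M.natRk_mono (Set.insert_subset ⟨hA, hB⟩ (Set.inter_subset_inter hcA hcB))
  have h3 := M.natRk_submod (M.closure A) (M.closure B)
  have h4 : M.natRk (A ∪ B) ≤ M.natRk (M.closure A ∪ M.closure B) :=
    M.natRk_mono (Set.union_subset_union hcA hcB)
  rw [natRk_closure, natRk_closure] at h3
  omega

theorem closure_eq_of_natRk_le (h : A ⊆ B) (hr : M.natRk B ≤ M.natRk A) :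
    M.closure A = M.closure B := by
  refine (M.isRkFinite_of_finite A.toFinite).closure_eq_closure_of_subset_of_eRk_ge_eRk h ?_
  simp only [← cast_natRk]
  exact_mod_cast hr

theorem natRk_union_le (M : Matroid ι) (A B : Set ι) :
    M.natRk (A ∪ B) ≤ M.natRk A + B.ncard := by
  have := M.natRk_submod A B
  have := M.natRk_le_ncard B
  omega

theorem Indep.isBase_of_natRk_le (hM : M.E = Set.univ) (hA : M.Indep A)
    (h : M.natRk Set.univ ≤ M.natRk A) : M.IsBase A := by
  refine hA.isBase_of_eRk_ge A.toFinite ?_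
  rw [← eRk_ground, hM]
  simp only [← cast_natRk]
  exact_mod_cast h

end Matroid

/-! ### Rooted trees as sets grown from the root -/

namespace Graph

variable {α β ι : Type*} {G : Graph α β} {T P F : Set β} {r u v x : α} {e : β}

theorem edgeVerts_mono (h : P ⊆ F) : G.edgeVerts P ⊆ G.edgeVerts F :=
  fun _ ⟨e, he, hi⟩ => ⟨e, h he, hi⟩

theorem edgeVerts_subset : G.edgeVerts F ⊆ V(G) :=
  fun _ ⟨_, _, hi⟩ => hi.vertex_mem

@[simp]
theorem edgeVerts_empty : G.edgeVerts ∅ = ∅ := by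
  ext; simp [edgeVerts]

theorem edgeVerts_insert (h : G.IsLink e u v) :
    G.edgeVerts (insert e T) = {u, v} ∪ G.edgeVerts T := by
  ext x
  constructor
  · rintro ⟨f, rfl | hf, hi⟩
    · rcases hi.eq_or_eq_of_isLink h with rfl | rfl <;> simp
    · exact Or.inr ⟨f, hf, hi⟩
  · rintro ((rfl | rfl) | ⟨f, hf, hi⟩)
    · exact ⟨e, by simp, h.inc_left⟩
    · exact ⟨e, by simp, h.inc_right⟩
    · exact ⟨f, Or.inr hf, hi⟩

theorem spannedVerts_insert (h : G.IsLink e u v) (hu : u ∈ G.spannedVerts T r) :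
    G.spannedVerts (insert e T) r = insert v (G.spannedVerts T r) := by
  rw [spannedVerts, edgeVerts_insert h]
  ext x
  simp only [spannedVerts, Set.mem_union, Set.mem_insert_iff, Set.mem_singleton_iff] at hu ⊢
  constructor
  · rintro (((rfl | rfl) | h) | h) <;> tauto
  · tauto

/-- Adjacency by an edge of `F`. -/
abbrev edgeRel (G : Graph α β) (F : Set β) (x y : α) : Prop := ∃ e ∈ F, G.IsLink e x y

theorem edgeRel_symm (h : Relation.ReflTransGen (G.edgeRel F) u v) :
    Relation.ReflTransGen (G.edgeRel F) v u :=
  have : Std.Symm (G.edgeRel F) := ⟨fun _ _ ⟨e, he, hl⟩ => ⟨e, he, hl.symm⟩⟩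
  Std.Symm.symm _ _ h

theorem edgeRel_mono (hPF : P ⊆ F) (h : Relation.ReflTransGen (G.edgeRel P) u v) :
    Relation.ReflTransGen (G.edgeRel F) u v :=
  Relation.ReflTransGen.mono (fun _ _ ⟨e, he, hl⟩ => ⟨e, hPF he, hl⟩) _ _ h

/-- The simple graph on the vertex type whose edges join the ends of the members of `F`. -/
def simpleOn (G : Graph α β) (F : Set β) : SimpleGraph α where
  Adj x y := x ≠ y ∧ G.edgeRel F x y
  symm := ⟨fun _ _ ⟨h, e, he, hl⟩ => ⟨h.symm, e, he, hl.symm⟩⟩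
  loopless := ⟨fun _ h => h.1 rfl⟩

/-- A walk in `P` between the ends of `e` shortens to a path, which `e` closes to a cycle. -/
theorem EdgesAcyclic.not_reflTransGen (hF : G.EdgesAcyclic F) (hPF : P ⊆ F) (heF : e ∈ F)
    (heP : e ∉ P) (he : G.IsLink e u v) : ¬ Relation.ReflTransGen (G.edgeRel P) v u := by
  classical
  intro hr
  have hreach : (G.simpleOn P).Reachable v u := by
    clear he
    induction hr with
    | refl => rfl
    | @tail b c _ hbc ih =>
      by_cases hb : b = c
      · exact hb ▸ ih
      · exact ih.trans (SimpleGraph.Adj.reachable (G := G.simpleOn P) ⟨hb, hbc⟩)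
  clear hr
  obtain ⟨p, hp⟩ := hreach.exists_isPath
  have hf : ∀ j, ∃ f, j < p.length → f ∈ P ∧ G.IsLink f (p.getVert j) (p.getVert (j + 1)) := by
    intro j
    by_cases hj : j < p.length
    · obtain ⟨-, f, hf, hl⟩ := p.adj_getVert_succ hj
      exact ⟨f, fun _ => ⟨hf, hl⟩⟩
    · exact ⟨e, fun h => absurd h hj⟩
  choose f hf using hf
  have hinj : ∀ i j, i ≤ p.length → j ≤ p.length → p.getVert i = p.getVert j → i = j :=
    fun i j hi hj h => hp.getVert_injOn hi hj h
  -- The last position carries the closing edge `e`; a path of length zero is the case of a loop.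
  refine hF p.length (fun i => p.getVert i) (fun i => if (i : ℕ) < p.length then f i else e)
    ⟨?_, ?_, ?_⟩ ?_
  · intro i j hij
    exact Fin.ext (hinj _ _ (by omega) (by omega) hij)
  · intro i j hij
    simp only at hij
    split_ifs at hij with hi hj hj
    · have h1 := (hf i hi).2
      have h2 := (hf j hj).2
      rw [← hij] at h2
      rcases h1.eq_and_eq_or_eq_and_eq h2 with ⟨h, -⟩ | ⟨h, h'⟩
      · exact Fin.ext (hinj _ _ (by omega) (by omega) h)
      · have := hinj _ _ (by omega) (by omega) h
        have := hinj _ _ (by omega) (by omega) h'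
        omega
    · exact absurd (hij ▸ (hf i hi).1) heP
    · exact absurd (hij ▸ (hf j hj).1) heP
    · exact Fin.ext (by omega)
  · intro i
    by_cases hi : (i : ℕ) < p.length
    · have h1 : ((i + 1 : Fin (p.length + 1)) : ℕ) = i + 1 :=
        Fin.val_add_one_of_lt (Fin.lt_def.2 hi)
      simp only [hi, if_true, h1]
      exact (hf i hi).2
    · have h1 : i = Fin.last _ := Fin.ext (by simp; omega)
      subst h1
      simpa using he
  · intro i
    split_ifs with hi
    · exact hPF (hf i hi).1
    · exact heF

/-- `Grown G r T`: the tree `T` arises from the root `r` by successively adding edges leading to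
new vertices. -/
inductive Grown (G : Graph α β) (r : α) : Set β → Prop
  | empty : Grown G r ∅
  | insert {T : Set β} {e : β} {u v : α} : Grown G r T → G.IsLink e u v →
      u ∈ G.spannedVerts T r → v ∉ G.spannedVerts T r → Grown G r (insert e T)

namespace Grown

theorem finite (h : G.Grown r T) : T.Finite := by
  induction h with
  | empty => exact Set.finite_empty
  | insert _ _ _ _ ih => exact ih.insert _

theorem subset_edgeSet (h : G.Grown r T) : T ⊆ E(G) := by
  induction h with
  | empty => simp
  | insert _ hl _ _ ih => exact Set.insert_subset hl.edge_mem ih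

theorem reach (h : G.Grown r T) (hx : x ∈ G.spannedVerts T r) :
    Relation.ReflTransGen (G.edgeRel T) r x := by
  induction h generalizing x with
  | empty =>
    simp only [spannedVerts, edgeVerts_empty, Set.empty_union, Set.mem_singleton_iff] at hx
    rw [hx]
  | insert _ hl hu _ ih =>
    rw [spannedVerts_insert hl hu] at hx
    rcases hx with rfl | hx
    · exact (edgeRel_mono (Set.subset_insert _ _) (ih hu)).tail ⟨_, Set.mem_insert _ _, hl⟩
    · exact edgeRel_mono (Set.subset_insert _ _) (ih hx)

/-- A cycle using the newest edge `e` passes through its new end `v`. Both cycle edges at `v` must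
be `e`, so the cycle is a loop, contradicting `u ≠ v`. -/
theorem acyclic (h : G.Grown r T) : G.EdgesAcyclic T := by
  induction h with
  | empty =>
    intro n w f _ hf
    exact hf 0
  | @insert T e u v _ hl hu hv ih =>
    intro n w f hc hf
    by_cases hall : ∀ i, f i ∈ T
    · exact ih n w f hc hall
    push Not at hall
    obtain ⟨i, hi⟩ := hall
    have hie : f i = e := (hf i).resolve_right hi
    have huv : u ≠ v := fun h => hv (h ▸ hu)
    have hli := hc.isLink i
    rw [hie] at hli
    obtain ⟨j, hj⟩ : ∃ j, w j = v := by
      rcases hl.eq_and_eq_or_eq_and_eq hli with ⟨-, h⟩ | ⟨-, h⟩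
      · exact ⟨_, h.symm⟩
      · exact ⟨_, h.symm⟩
    have key : ∀ m, f m ≠ e → G.Inc (f m) v → False := fun m hm hinc =>
      hv (Or.inl ⟨f m, (hf m).resolve_left hm, hinc⟩)
    have h1 : G.Inc (f j) v := hj ▸ (hc.isLink j).inc_left
    have h2 : G.Inc (f (j - 1)) v := by
      have := (hc.isLink (j - 1)).inc_right
      rwa [sub_add_cancel, hj] at this
    have e1 : f j = e := by_contra fun h => key _ h h1
    have e2 : f (j - 1) = e := by_contra fun h => key _ h h2
    have h3 := hc.edge_injective (e1.trans e2.symm)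
    have h4 : (1 : Fin (n + 1)) = 0 := sub_eq_self.1 h3.symm
    rw [h4, add_zero] at hli
    rcases hl.eq_and_eq_or_eq_and_eq hli with ⟨h, h'⟩ | ⟨h, h'⟩ <;> exact huv (h.trans h'.symm)

theorem root_mem_edgeVerts (h : G.Grown r T) (hT : T ≠ ∅) : r ∈ G.edgeVerts T := by
  induction h with
  | empty => exact absurd rfl hT
  | @insert T e u v _ hl hu hv ih =>
    rw [edgeVerts_insert hl]
    rcases hu with hu | rfl
    · refine Or.inr (ih ?_)
      rintro rfl
      simp at hu
    · simp

theorem isRootedTree (h : G.Grown r T) (hr : r ∈ V(G)) : G.IsRootedTree T r := by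
  refine ⟨h.subset_edgeSet, hr, ?_⟩
  by_cases hT : T = ∅
  · exact Or.inl hT
  · exact Or.inr ⟨fun u hu v hv => (edgeRel_symm (h.reach (Or.inl hu))).trans
      (h.reach (Or.inl hv)), h.acyclic, h.root_mem_edgeVerts hT⟩

theorem finite_spannedVerts (h : G.Grown r T) : (G.spannedVerts T r).Finite := by
  induction h with
  | empty => simp [spannedVerts]
  | insert _ hl hu _ ih =>
    rw [spannedVerts_insert hl hu]
    exact ih.insert _

theorem ncard_spannedVerts (h : G.Grown r T) : (G.spannedVerts T r).ncard = T.ncard + 1 := by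
  induction h with
  | empty => simp [spannedVerts]
  | @insert T e u v hg hl hu hv ih =>
    have he : e ∉ T := fun he => hv (Or.inl ⟨e, he, hl.inc_right⟩)
    rw [spannedVerts_insert hl hu, Set.ncard_insert_of_notMem hv hg.finite_spannedVerts,
      Set.ncard_insert_of_notMem he hg.finite, ih]

/-- Deleting the newest edge from `F` also loses its new end, which no older edge touches. -/
theorem ncard_lt_of_subset (h : G.Grown r T) (hF : F ⊆ T) (hne : F.Nonempty) :
    F.ncard < (G.edgeVerts F).ncard := by
  induction h generalizing F with
  | empty => exact absurd (hne.mono hF) (by simp)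
  | @insert T e u v hg hl hu hv ih =>
    have hfin : (G.edgeVerts T).Finite := hg.finite_spannedVerts.subset Set.subset_union_left
    by_cases he : e ∈ F
    · have hF' : F \ {e} ⊆ T := by
        rintro f ⟨hf, hfe⟩
        exact (hF hf).resolve_left hfe
      have hFi : Insert.insert e (F \ {e}) = F := by simp [he]
      have hfinF : (F \ {e}).Finite := hg.finite.subset hF'
      have hfinV : (G.edgeVerts (F \ {e})).Finite := hfin.subset (edgeVerts_mono hF')
      rw [← hFi, Set.ncard_insert_of_notMem (by simp) hfinF, edgeVerts_insert hl]
      rcases (F \ {e}).eq_empty_or_nonempty with h0 | h0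
      · have huv : u ≠ v := fun h => hv (h ▸ hu)
        simp [h0, Set.ncard_pair huv]
      · have := ih hF' h0
        have hv' : v ∉ G.edgeVerts (F \ {e}) := fun hh => hv (Or.inl (edgeVerts_mono hF' hh))
        have h2 := Set.ncard_insert_of_notMem hv' hfinV
        have h3 : (Insert.insert v (G.edgeVerts (F \ {e}))).ncard ≤
            ({u, v} ∪ G.edgeVerts (F \ {e})).ncard := by
          refine Set.ncard_le_ncard ?_ ((Set.toFinite _).union hfinV)
          intro x hx
          rcases hx with rfl | hx
          · simp
          · exact Or.inr hx
        omega
    · exact ih (fun f hf => (hF hf).resolve_left (fun h => he (h ▸ hf))) hne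

end Grown

/-- Take a maximal grown `P ⊆ T`. An edge of `T` outside `P` touching the spanned set would either
extend `P` or close a cycle, so connectedness yields `P = T`. -/
theorem IsRootedTree.grown (h : G.IsRootedTree T r) (hfin : T.Finite) : G.Grown r T := by
  rcases h.tree with rfl | ⟨hconn, hac, hr⟩
  · exact .empty
  obtain ⟨P, hP⟩ := (hfin.finite_subsets.subset
    (fun P (hP : P ⊆ T ∧ G.Grown r P) => hP.1)).exists_maximal ⟨∅, Set.empty_subset _, .empty⟩
  obtain ⟨hPT, hPg⟩ := hP.prop
  have hmax : ∀ f ∈ T, f ∉ P → ∀ a b, G.IsLink f a b → a ∈ G.spannedVerts P r → False := by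
    intro f hf hfP a b hl ha
    by_cases hb : b ∈ G.spannedVerts P r
    · exact hac.not_reflTransGen hPT hf hfP hl
        ((edgeRel_symm (hPg.reach hb)).trans (hPg.reach ha))
    · exact hfP (hP.le_of_ge ⟨Set.insert_subset hf hPT, hPg.insert hl ha hb⟩
        (Set.subset_insert _ _) (Set.mem_insert _ _))
  have hreach : ∀ x, Relation.ReflTransGen (G.edgeRel T) r x → x ∈ G.spannedVerts P r := by
    intro x hx
    induction hx with
    | refl => exact Or.inr rfl
    | tail _ hbc ih =>
      obtain ⟨f, hf, hl⟩ := hbc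
      by_cases hfP : f ∈ P
      · exact Or.inl ⟨f, hfP, hl.inc_right⟩
      · exact (hmax f hf hfP _ _ hl ih).elim
  have hTP : T ⊆ P := by
    intro f hf
    by_contra hfP
    obtain ⟨a, b, hl⟩ := exists_isLink_of_mem_edgeSet (h.subset_edgeSet hf)
    exact hmax f hf hfP a b hl (hreach a (hconn r hr a ⟨f, hf, hl.inc_left⟩))
  exact hPT.antisymm hTP ▸ hPg

end Graph
-- Double counting
section DoubleCounting

variable {α β ι : Type*}

theorem sum_ncard_inter_eq [Fintype ι] (W : Finset α) (P : ι → Set α) :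
    ∑ i, (P i ∩ W).ncard = ∑ v ∈ W, {i | v ∈ P i}.ncard := by
  classical
  have h1 : ∀ i, (P i ∩ W).ncard = (W.filter (· ∈ P i)).card := fun i => by
    rw [← Set.ncard_coe_finset]; congr 1; ext; simp [and_comm]
  have h2 : ∀ v, {i | v ∈ P i}.ncard = (Finset.univ.filter (fun i => v ∈ P i)).card := fun v => by
    rw [← Set.ncard_coe_finset]; congr 1; ext; simp
  simp only [h1, h2]
  exact Finset.sum_card_bipartiteAbove_eq_sum_card_bipartiteBelow (fun i v => v ∈ P i)

theorem ncard_iUnion_of_disjoint [Fintype ι] {T : ι → Set β} (hfin : ∀ i, (T i).Finite)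
    (hd : ∀ i j, i ≠ j → Disjoint (T i) (T j)) : (⋃ i, T i).ncard = ∑ i, (T i).ncard := by
  rw [← finsum_eq_sum_of_fintype]
  exact Set.ncard_iUnion_of_finite hfin hd

theorem ncard_rootsIn [Finite ι] (root : ι → α) (X : Finset α) :
    (rootsIn root X).ncard = ∑ v ∈ X, (rootsIn root {v}).ncard := by
  classical
  have := Fintype.ofFinite ι
  have h := sum_ncard_inter_eq X (fun i => ({root i} : Set α))
  have h1 : ∀ v, {i | v ∈ ({root i} : Set α)} = rootsIn root {v} := fun v => by
    ext i; exact eq_comm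
  simp only [h1] at h
  rw [← h, show rootsIn root X = ((Finset.univ.filter (fun i => root i ∈ X) : Finset ι) : Set ι) by
    ext; simp [rootsIn], Set.ncard_coe_finset, Finset.card_filter]
  refine Finset.sum_congr rfl fun i _ => ?_
  split_ifs with hi
  · rw [Set.inter_eq_left.2 (by simpa using hi)]; simp
  · rw [Set.singleton_inter_eq_empty.2 (by simpa using hi)]; simp

end DoubleCounting

/-! ### Cuts, tight sets and admissible arcs -/

section Arcs

variable {α β ι : Type*}

open Classical in
/-- The arcs in `A` entering the vertex set `X`. -/
noncomputable def enteringArcs (A : Finset β) (tl hd : β → α) (X : Finset α) : Finset β :=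
  A.filter (fun e => hd e ∈ X ∧ tl e ∉ X)

/-- The union of the sets `S x` over `x ∈ X`. -/
def labelUnion (S : α → Set ι) (X : Finset α) : Set ι := {i | ∃ x ∈ X, i ∈ S x}

variable {A : Finset β} {tl hd : β → α} {S : α → Set ι} {X Y V : Finset α} {M : Matroid ι}
  {k : ℕ} {v : α}

@[simp]
theorem mem_enteringArcs {e : β} :
    e ∈ enteringArcs A tl hd X ↔ e ∈ A ∧ hd e ∈ X ∧ tl e ∉ X := by
  simp [enteringArcs]

theorem enteringArcs_submod [DecidableEq α] (A : Finset β) (tl hd : β → α) (X Y : Finset α) :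
    (enteringArcs A tl hd (X ∩ Y)).card + (enteringArcs A tl hd (X ∪ Y)).card ≤
      (enteringArcs A tl hd X).card + (enteringArcs A tl hd Y).card := by
  classical
  rw [← Finset.card_union_add_card_inter, ← Finset.card_union_add_card_inter (enteringArcs _ _ _ X)]
  refine Nat.add_le_add (Finset.card_le_card fun e => ?_) (Finset.card_le_card fun e => ?_)
  all_goals
    simp only [Finset.mem_union, Finset.mem_inter, mem_enteringArcs]
    tauto

theorem subset_labelUnion (h : v ∈ X) : S v ⊆ labelUnion S X := fun _ hi => ⟨v, h, hi⟩

theorem labelUnion_mono (h : X ⊆ Y) : labelUnion S X ⊆ labelUnion S Y :=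
  fun _ ⟨x, hx, hi⟩ => ⟨x, h hx, hi⟩

theorem labelUnion_union [DecidableEq α] :
    labelUnion S (X ∪ Y) = labelUnion S X ∪ labelUnion S Y := by
  ext i
  simp only [labelUnion, Finset.mem_union, Set.mem_union, Set.mem_ofPred_eq]
  constructor
  · rintro ⟨x, h | h, hi⟩
    exacts [Or.inl ⟨x, h, hi⟩, Or.inr ⟨x, h, hi⟩]
  · rintro (⟨x, h, hi⟩ | ⟨x, h, hi⟩)
    exacts [⟨x, Or.inl h, hi⟩, ⟨x, Or.inr h, hi⟩]

variable [Finite ι]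

/-- Uncrossing of two intersecting tight sets. -/
theorem tight_inter [DecidableEq α] (hM : M.E = Set.univ)
    (hconn : ∀ X ⊆ V, X.Nonempty →
      k ≤ (enteringArcs A tl hd X).card + M.natRk (labelUnion S X))
    (hXV : X ⊆ V) (hYV : Y ⊆ V) (hne : (X ∩ Y).Nonempty)
    (hX : (enteringArcs A tl hd X).card + M.natRk (labelUnion S X) ≤ k)
    (hY : (enteringArcs A tl hd Y).card + M.natRk (labelUnion S Y) ≤ k) :
    (enteringArcs A tl hd (X ∩ Y)).card + M.natRk (labelUnion S (X ∩ Y)) ≤ k ∧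
      M.closure (labelUnion S X) ∩ M.closure (labelUnion S Y) ⊆
        M.closure (labelUnion S (X ∩ Y)) := by
  have h1 := hconn _ (Finset.inter_subset_left.trans hXV) hne
  have h2 := hconn _ (Finset.union_subset hXV hYV)
    (hne.mono (Finset.inter_subset_left.trans Finset.subset_union_left))
  have h3 := enteringArcs_submod A tl hd X Y
  have h4 := M.natRk_submod (labelUnion S X) (labelUnion S Y)
  have hsub : labelUnion S (X ∩ Y) ⊆ labelUnion S X ∩ labelUnion S Y :=
    Set.subset_inter (labelUnion_mono Finset.inter_subset_left)
      (labelUnion_mono Finset.inter_subset_right)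
  have h5 := M.natRk_mono hsub
  rw [labelUnion_union] at h2
  -- The cut condition at `X ∩ Y` and `X ∪ Y` forces equality throughout: the labels of `X ∩ Y` have
  -- the rank of the intersection of the two label unions, and these form a modular pair.
  refine ⟨by omega, ?_⟩
  rw [Matroid.closure_eq_of_natRk_le hsub (by omega)]
  rintro x ⟨hx, hy⟩
  exact Matroid.mem_closure_inter_of_modular hM (by omega) hx hy

/-- Otherwise labels only propagate within closures along arcs inside `X`. Let `Y` be the part of
`X` from which `v` is reachable inside `X`; its labels lie in the closure of `S v`. An arc entering
`Y` also enters `X`, so the cut condition gives `Y` the full label rank of `X`, and all labels of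
`X` lie in that closure. -/
theorem exists_arc_of_not_subset_closure (hM : M.E = Set.univ)
    (hconn : ∀ X ⊆ V, X.Nonempty →
      k ≤ (enteringArcs A tl hd X).card + M.natRk (labelUnion S X))
    (hXV : X ⊆ V) (hX : (enteringArcs A tl hd X).card + M.natRk (labelUnion S X) ≤ k)
    (hv : v ∈ X) (hS : ¬ labelUnion S X ⊆ M.closure (S v)) :
    ∃ e ∈ A, hd e ∈ X ∧ tl e ∈ X ∧ ∃ s ∈ S (tl e), s ∉ M.closure (S (hd e)) := by
  classical
  by_contra! hno
  let rel : α → α → Prop := fun a b => ∃ e ∈ A, hd e ∈ X ∧ tl e ∈ X ∧ tl e = a ∧ hd e = b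
  let Y := X.filter (fun y => Relation.ReflTransGen rel y v)
  have hYX : Y ⊆ X := Finset.filter_subset _ _
  have hYv : ∀ y, Relation.ReflTransGen rel y v → S y ⊆ M.closure (S v) := by
    intro y hy
    induction hy using Relation.ReflTransGen.head_induction_on with
    | refl => exact Matroid.subset_closure_of_ground_eq_univ hM _
    | head hab _ ih =>
      obtain ⟨e, he, h1, h2, rfl, rfl⟩ := hab
      exact fun s hs => M.closure_subset_closure_of_subset_closure ih (hno e he h1 h2 s hs)
  have hcard : (enteringArcs A tl hd Y).card ≤ (enteringArcs A tl hd X).card := by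
    refine Finset.card_le_card fun e => ?_
    simp only [mem_enteringArcs]
    rintro ⟨he, h1, h2⟩
    refine ⟨he, hYX h1, fun h3 => h2 ?_⟩
    exact Finset.mem_filter.2 ⟨h3, .head ⟨e, he, hYX h1, h3, rfl, rfl⟩ (Finset.mem_filter.1 h1).2⟩
  have hk := hconn Y (hYX.trans hXV) ⟨v, Finset.mem_filter.2 ⟨hv, .refl⟩⟩
  have hcl := Matroid.closure_eq_of_natRk_le (M := M) (labelUnion_mono (S := S) hYX) (by omega)
  refine hS ((Matroid.subset_closure_of_ground_eq_univ hM _).trans ?_)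
  rw [← hcl]
  refine M.closure_subset_closure_of_subset_closure ?_
  rintro i ⟨y, hy, hi⟩
  exact hYv y (Finset.mem_filter.1 hy).2 hi

/-- Descent on tight sets: `V` is tight and contains an arc with a new label. If every such arc is
blocked by a tight set `Y`, then intersecting `Y` with the current tight set `X` gives a smaller
one, since the arc is chosen inside `X` with its tail outside `Y`. -/
theorem exists_admissible_arc (hM : M.E = Set.univ)
    (hA : ∀ e ∈ A, tl e ∈ V)
    (hconn : ∀ X ⊆ V, X.Nonempty →
      k ≤ (enteringArcs A tl hd X).card + M.natRk (labelUnion S X))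
    (hk : M.natRk Set.univ = k) (hv : v ∈ V) (hvk : M.natRk (S v) < k) :
    ∃ e ∈ A, ∃ s ∈ S (tl e), s ∉ M.closure (S (hd e)) ∧
      ∀ X ⊆ V, hd e ∈ X → tl e ∉ X → s ∈ M.closure (labelUnion S X) →
        k < (enteringArcs A tl hd X).card + M.natRk (labelUnion S X) := by
  classical
  by_contra! hno
  -- The tail of `e` is not required to lie outside `X`, so the descent can start at `V` itself.
  have hmin : ∀ n, ∀ X ⊆ V, X.card = n →
      (enteringArcs A tl hd X).card + M.natRk (labelUnion S X) ≤ k →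
      ∀ e ∈ A, ∀ s, s ∉ M.closure (S (hd e)) → hd e ∈ X → s ∈ M.closure (labelUnion S X) →
      False := by
    intro n
    induction n using Nat.strong_induction_on with
    | _ n ih =>
    intro X hXV hXn hX e he s hs heX hsX
    obtain ⟨f, hf, hfh, hft, t, ht, htc⟩ := exists_arc_of_not_subset_closure hM hconn hXV hX heX
      (fun h => hs (M.closure_subset_closure_of_subset_closure h hsX))
    obtain ⟨Y, hYV, hfY, hfY', htY, hY⟩ := hno f hf t ht htc
    obtain ⟨h1, h2⟩ := tight_inter hM hconn hXV hYV ⟨_, Finset.mem_inter.2 ⟨hfh, hfY⟩⟩ hX hY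
    refine ih (X ∩ Y).card ?_ (X ∩ Y) (Finset.inter_subset_left.trans hXV) rfl h1 f hf t htc
      (Finset.mem_inter.2 ⟨hfh, hfY⟩)
      (h2 ⟨Matroid.subset_closure_of_ground_eq_univ hM _ (subset_labelUnion hft ht), htY⟩)
    rw [← hXn]
    refine Finset.card_lt_card ⟨Finset.inter_subset_left, fun h => ?_⟩
    exact hfY' (Finset.mem_inter.1 (h hft)).2
  have hV0 : (enteringArcs A tl hd V).card = 0 := by
    rw [Finset.card_eq_zero, Finset.eq_empty_iff_forall_notMem]
    simp only [mem_enteringArcs]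
    exact fun e he => he.2.2 (hA e he.1)
  have hVt : (enteringArcs A tl hd V).card + M.natRk (labelUnion S V) ≤ k := by
    rw [hV0, zero_add, ← hk]
    exact M.natRk_mono (Set.subset_univ _)
  have hVk := hconn V subset_rfl ⟨v, hv⟩
  obtain ⟨f, hf, hfh, hft, t, ht, htc⟩ := exists_arc_of_not_subset_closure hM hconn subset_rfl hVt
    hv (fun h => by
      have := M.natRk_mono h
      rw [Matroid.natRk_closure] at this
      omega)
  exact hmin _ V subset_rfl rfl hVt f hf t htc hfh
    (Matroid.subset_closure_of_ground_eq_univ hM _ (subset_labelUnion hft ht))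

end Arcs
-- Orientation and growth of the decomposition
namespace Graph

variable {α β ι : Type*} {G : Graph α β}

/-- An orientation of `G` in which the in-degree of `v` is at most `m v`. -/
theorem exists_orientation_of_card_le [Nonempty α] (V : Finset α)
    (hV : ∀ v, v ∈ V ↔ v ∈ V(G)) (E : Finset β) (m : α → ℕ)
    (h : ∀ F ⊆ E, ∀ W : Finset α, (∀ v, v ∈ W ↔ v ∈ G.edgeVerts F) → F.card ≤ ∑ v ∈ W, m v) :
    ∃ tl hd : β → α, (∀ e ∈ E, G.IsLink e (tl e) (hd e)) ∧
      ∀ X : Finset α, {e ∈ (E : Set β) | hd e ∈ X}.ncard ≤ ∑ v ∈ X, m v := by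
  classical
  -- Each vertex `v` offers `m v` slots. Hall's theorem gives every edge its own slot at one of its
  -- ends, which becomes the head.
  let t : E → Finset (Σ _ : α, ℕ) := fun e =>
    (V.filter (fun v => G.Inc e v)).sigma (fun v => Finset.range (m v))
  obtain ⟨f, hf, hft⟩ := (Finset.all_card_le_biUnion_card_iff_exists_injective t).1 (fun F => by
    let W := V.filter (fun v => v ∈ G.edgeVerts (F.map (Function.Embedding.subtype _) : Finset β))
    have h1 := h (F.map (Function.Embedding.subtype _)) (fun e he => by
      obtain ⟨x, -, rfl⟩ := Finset.mem_map.1 he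
      exact x.2) W (fun v => by
        simp only [W, Finset.mem_filter, and_iff_right_iff_imp]
        exact fun hv => (hV v).2 (edgeVerts_subset hv))
    rw [Finset.card_map] at h1
    refine h1.trans ?_
    have h2 : W.sigma (fun v => Finset.range (m v)) ⊆ F.biUnion t := by
      rintro ⟨v, j⟩ hvj
      obtain ⟨hv, hj⟩ := Finset.mem_sigma.1 hvj
      obtain ⟨hvV, e, he, hi⟩ := Finset.mem_filter.1 hv
      obtain ⟨x, hx, rfl⟩ := Finset.mem_map.1 (Finset.mem_coe.1 he)
      exact Finset.mem_biUnion.2 ⟨x, hx, Finset.mem_sigma.2 ⟨Finset.mem_filter.2 ⟨hvV, hi⟩, hj⟩⟩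
    simpa using Finset.card_le_card h2)
  have hinc : ∀ e, ∃ x y, ∀ he : e ∈ E, y = (f ⟨e, he⟩).1 ∧ G.IsLink e x y := by
    intro e
    by_cases he : e ∈ E
    · have h1 := (Finset.mem_sigma.1 (hft ⟨e, he⟩)).1
      obtain ⟨x, hx⟩ := (Finset.mem_filter.1 h1).2
      exact ⟨x, _, fun _ => ⟨rfl, hx.symm⟩⟩
    · exact ⟨Classical.arbitrary α, Classical.arbitrary α, fun h => absurd h he⟩
  choose tl hd hlink using hinc
  refine ⟨tl, hd, fun e he => (hlink e he).2, fun X => ?_⟩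
  have h3 : {e ∈ (E : Set β) | hd e ∈ X} = ((E.filter (fun e => hd e ∈ X) : Finset β) : Set β) := by
    ext; simp
  rw [h3, Set.ncard_coe_finset, ← Finset.card_attach]
  calc _ ≤ (X.sigma (fun v => Finset.range (m v))).card := by
        refine Finset.card_le_card_of_injOn
          (fun e => f ⟨e.1, (Finset.mem_filter.1 e.2).1⟩) ?_ ?_
        · intro e _
          obtain ⟨heE, heX⟩ := Finset.mem_filter.1 e.2
          refine Finset.mem_sigma.2 ⟨?_, (Finset.mem_sigma.1 (hft _)).2⟩
          rw [(hlink e.1 heE).1] at heX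
          exact heX
        · intro a _ b _ hab
          have := hf hab
          simp only [Subtype.mk.injEq] at this
          exact Subtype.ext this
    _ = _ := by simp

variable [Finite ι] {root : ι → α} {M : Matroid ι}
  {T : ι → Set β} {k : ℕ}

theorem ncard_iUnion_grown (V : Finset α) (hV : ∀ v, v ∈ V ↔ v ∈ V(G))
    (hroot : ∀ i, root i ∈ V(G)) (hg : ∀ i, G.Grown (root i) (T i))
    (hdisj : ∀ i j, i ≠ j → Disjoint (T i) (T j)) :
    (⋃ i, T i).ncard + (Set.univ : Set ι).ncard =
      ∑ v ∈ V, {i | v ∈ G.spannedVerts (T i) (root i)}.ncard := by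
  have := Fintype.ofFinite ι
  have hsub : ∀ i, G.spannedVerts (T i) (root i) ∩ V = G.spannedVerts (T i) (root i) := by
    refine fun i => Set.inter_eq_left.2 fun x hx => (hV x).2 ?_
    rcases hx with hx | rfl
    exacts [edgeVerts_subset hx, hroot i]
  rw [← sum_ncard_inter_eq V (fun i => G.spannedVerts (T i) (root i)),
    ncard_iUnion_of_disjoint (fun i => (hg i).finite) hdisj]
  simp [hsub, (hg _).ncard_spannedVerts, Finset.sum_add_distrib, Set.ncard_univ]

/-- Induction on the number of unused arcs; disjointness, independence of the labels and the cut
condition are the invariants. -/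
theorem exists_basicDecomposition_of_partial (hE : E(G).Finite) (V : Finset α)
    (hV : ∀ v, v ∈ V ↔ v ∈ V(G)) (hroot : ∀ i, root i ∈ V(G)) (hM : M.E = Set.univ)
    (hk : M.natRk Set.univ = k) (hcard : E(G).ncard + (Set.univ : Set ι).ncard = k * V(G).ncard)
    (tl hd : β → α) (A : Finset β) (hl : ∀ e ∈ A, G.IsLink e (tl e) (hd e))
    (hg : ∀ i, G.Grown (root i) (T i))
    (hdisj : ∀ i j, i ≠ j → Disjoint (T i) (T j)) (hAT : ∀ i, ∀ e ∈ A, e ∉ T i)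
    (hcover : ∀ e ∈ E(G), e ∈ A ∨ ∃ i, e ∈ T i)
    (hind : ∀ v ∈ V, M.Indep {i | v ∈ G.spannedVerts (T i) (root i)})
    (hconn : ∀ X ⊆ V, X.Nonempty → k ≤ (enteringArcs A tl hd X).card +
      M.natRk (labelUnion (fun v => {i | v ∈ G.spannedVerts (T i) (root i)}) X)) :
    ∃ T', G.IsBasicDecomposition root M T' := by
  classical
  induction hn : A.card generalizing A T with
  | zero =>
    obtain rfl := Finset.card_eq_zero.1 hn
    refine ⟨T, fun i => (hg i).isRootedTree (hroot i), hdisj, ?_, fun v hv => ?_⟩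
    · refine (Set.iUnion_subset fun i => (hg i).subset_edgeSet).antisymm fun e he => ?_
      exact Set.mem_iUnion.2 ((hcover e he).resolve_left (by simp))
    · refine (hind v ((hV v).2 hv)).isBase_of_natRk_le hM ?_
      rw [hk]
      simpa [enteringArcs, labelUnion] using
        hconn {v} (Finset.singleton_subset_iff.2 ((hV v).2 hv)) ⟨v, by simp⟩
  | succ n ih =>
    set S : α → Set ι := fun v => {i | v ∈ G.spannedVerts (T i) (root i)} with hS
    -- If every vertex had full label rank, the trees would already use at least `k|V| - t = |E|`
    -- edges, `t` being the number of roots, although an arc is left over.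
    obtain ⟨v, hv, hvk⟩ : ∃ v ∈ V, M.natRk (S v) < k := by
      by_contra! hno
      have h1 := ncard_iUnion_grown V hV hroot hg hdisj
      have h2 : k * V.card ≤ ∑ v ∈ V, (S v).ncard := by
        rw [mul_comm, ← smul_eq_mul]
        exact Finset.card_nsmul_le_sum _ _ _ fun v hv => (hno v hv).trans (M.natRk_le_ncard _)
      obtain ⟨e, he⟩ := Finset.card_pos.1 (by omega : 0 < A.card)
      have h3 : (⋃ i, T i).ncard < E(G).ncard := by
        refine Set.ncard_lt_ncard ⟨Set.iUnion_subset fun i => (hg i).subset_edgeSet, fun h => ?_⟩ hE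
        obtain ⟨i, hi⟩ := Set.mem_iUnion.1 (h (hl e he).edge_mem)
        exact hAT i e he hi
      have h4 : V(G).ncard = V.card := by
        rw [← Set.ncard_coe_finset]; congr 1; ext x; exact (hV x).symm
      rw [h4] at hcard
      simp only [hS] at h2
      omega
    obtain ⟨e, he, s, hsu, hsv, htight⟩ := exists_admissible_arc hM
      (fun e he => (hV _).2 (hl e he).left_mem) hconn hk hv hvk
    have hle := hl e he
    have hsv' : s ∉ S (hd e) :=
      fun h => hsv (Matroid.subset_closure_of_ground_eq_univ hM _ h)
    -- Adding `e` to tree `s` changes the labels only at the head of `e`.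
    have hS' : ∀ w, {i | w ∈ G.spannedVerts (Function.update T s (insert e (T s)) i) (root i)} =
        if w = hd e then insert s (S w) else S w := by
      intro w
      ext i
      by_cases his : i = s
      · subst his
        rw [Set.mem_ofPred_eq, Function.update_self, spannedVerts_insert hle hsu]
        split_ifs with hw
        · simp [hw]
        · simp [hw, hS]
      · rw [Set.mem_ofPred_eq, Function.update_of_ne his]
        split_ifs with hw
        · simp [his, hS]
        · simp [hS]
    refine ih (T := Function.update T s (insert e (T s))) (A := A.erase e)
      (fun f hf => hl f (Finset.mem_of_mem_erase hf)) ?_ ?_ ?_ ?_ ?_ ?_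
      (by rw [Finset.card_erase_of_mem he, hn]; rfl)
    · intro i
      by_cases his : i = s
      · subst his
        rw [Function.update_self]
        exact (hg i).insert hle hsu hsv'
      · rw [Function.update_of_ne his]
        exact hg i
    · intro i j hij
      by_cases his : i = s
      · subst his
        rw [Function.update_self, Function.update_of_ne hij.symm, Set.disjoint_insert_left]
        exact ⟨hAT j e he, hdisj i j hij⟩
      · rw [Function.update_of_ne his]
        by_cases hjs : j = s
        · subst hjs
          rw [Function.update_self, Set.disjoint_insert_right]
          exact ⟨hAT i e he, hdisj i j hij⟩
        · rw [Function.update_of_ne hjs]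
          exact hdisj i j hij
    · intro i f hf
      obtain ⟨hfe, hfA⟩ := Finset.mem_erase.1 hf
      by_cases his : i = s
      · subst his
        rw [Function.update_self]
        exact fun h => h.elim hfe (hAT i f hfA)
      · rw [Function.update_of_ne his]
        exact hAT i f hfA
    · intro f hf
      by_cases hfe : f = e
      · exact Or.inr ⟨s, by simp [hfe]⟩
      · rcases hcover f hf with h | ⟨i, hi⟩
        · exact Or.inl (Finset.mem_erase.2 ⟨hfe, h⟩)
        · refine Or.inr ⟨i, ?_⟩
          by_cases his : i = s
          · subst his
            rw [Function.update_self]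
            exact Or.inr hi
          · rwa [Function.update_of_ne his]
    · intro w hw
      rw [hS']
      split_ifs with h
      · subst h
        exact ((hind _ hw).notMem_closure_iff (hM ▸ Set.mem_univ s)).1 hsv |>.1
      · exact hind w hw
    · intro X hXV hX
      simp only [hS']
      set S' : α → Set ι := fun w => if w = hd e then insert s (S w) else S w with hS'def
      have hsub : labelUnion S X ⊆ labelUnion S' X := by
        rintro i ⟨x, hx, hi⟩
        refine ⟨x, hx, ?_⟩
        simp only [hS'def]
        split_ifs
        exacts [Or.inr hi, hi]
      have hr := M.natRk_mono hsub
      have hc := hconn X hXV hX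
      have her : enteringArcs (A.erase e) tl hd X = (enteringArcs A tl hd X).erase e := by
        ext f
        simp only [mem_enteringArcs, Finset.mem_erase]
        tauto
      rw [her]
      by_cases hent : e ∈ enteringArcs A tl hd X
      · obtain ⟨-, h1, h2⟩ := mem_enteringArcs.1 hent
        have hpos := Finset.card_pos.2 ⟨e, hent⟩
        rw [Finset.card_erase_of_mem hent]
        -- The loss of one entering arc is paid for by the slack from admissibility if `s` is
        -- already spanned, and otherwise by a rank increase of one.
        by_cases hcl : s ∈ M.closure (labelUnion S X)
        · have := htight X hXV h1 h2 hcl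
          omega
        · have h3 := Matroid.natRk_insert hM hcl
          have h4 : M.natRk (insert s (labelUnion S X)) ≤ M.natRk (labelUnion S' X) := by
            refine M.natRk_mono (Set.insert_subset ⟨hd e, h1, ?_⟩ hsub)
            simp [hS'def]
          omega
      · rw [Finset.erase_eq_of_notMem hent]
        omega

end Graph
-- Sufficiency and necessity of the conditions
namespace Graph

variable {α β ι : Type*} {G : Graph α β} {root : ι → α} {M : Matroid ι} {k : ℕ}

theorem exists_basicDecomposition [Finite ι] (hV : V(G).Finite) (hE : E(G).Finite)
    (hroot : ∀ i, root i ∈ V(G)) (hM : M.E = Set.univ) (hk : M.natRk Set.univ = k)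
    (hind : ∀ v ∈ V(G), M.Indep (rootsIn root {v}))
    (hsparse : ∀ F ⊆ E(G), F.Nonempty →
      F.ncard + (rootsIn root (G.edgeVerts F)).ncard + k ≤
        k * (G.edgeVerts F).ncard + M.natRk (rootsIn root (G.edgeVerts F)))
    (hcard : E(G).ncard + (Set.univ : Set ι).ncard = k * V(G).ncard) :
    ∃ T, G.IsBasicDecomposition root M T := by
  classical
  -- The orientation lemma needs a default vertex, so the empty graph is treated apart.
  rcases V(G).eq_empty_or_nonempty with hV0 | ⟨v₀, hv₀⟩
  · have hE0 : E(G) = ∅ := by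
      rw [Set.eq_empty_iff_forall_notMem]
      intro e he
      obtain ⟨x, y, hl⟩ := exists_isLink_of_mem_edgeSet he
      exact (hV0 ▸ hl.left_mem : x ∈ (∅ : Set α))
    have hι : IsEmpty ι := ⟨fun i => (hV0 ▸ hroot i : root i ∈ (∅ : Set α))⟩
    exact ⟨fun _ => ∅, fun i => hι.elim i, fun i => hι.elim i, by simp [hE0], by simp [hV0]⟩
  have : Nonempty α := ⟨v₀⟩
  obtain ⟨V, hVV⟩ := hV.exists_finset
  obtain ⟨E, hEE⟩ := hE.exists_finset
  have hVcoe : (V : Set α) = V(G) := by ext; simp [hVV]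
  have hEcoe : (E : Set β) = E(G) := by ext; simp [hEE]
  rw [← hVcoe, ← hEcoe, Set.ncard_coe_finset, Set.ncard_coe_finset] at hcard
  have hrk : ∀ v ∈ V, (rootsIn root {v}).ncard ≤ k := fun v hv => by
    rw [← (hind v ((hVV v).1 hv)).natRk_eq_ncard, ← hk]
    exact M.natRk_mono (Set.subset_univ _)
  -- The number of trees that must enter `v` through an arc; by `hrk` the subtraction does not
  -- truncate.
  let m : α → ℕ := fun v => k - (rootsIn root {v}).ncard
  have hm : ∀ X ⊆ V, ∑ v ∈ X, m v + (rootsIn root (X : Set α)).ncard = k * X.card := by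
    intro X hX
    rw [ncard_rootsIn, ← Finset.sum_add_distrib, Finset.sum_congr rfl
      (fun v hv => Nat.sub_add_cancel (hrk v (hX hv)))]
    simp [mul_comm]
  obtain ⟨tl, hd, hlink, hdeg⟩ := exists_orientation_of_card_le V hVV E m (by
    intro F hF W hW
    rcases F.eq_empty_or_nonempty with rfl | hne
    · simp
    have hWc : (W : Set α) = G.edgeVerts F := by ext; simp [hW]
    have h1 := hsparse F (hEcoe ▸ Finset.coe_subset.2 hF) hne
    rw [← hWc, Set.ncard_coe_finset, Set.ncard_coe_finset] at h1
    have h2 := hm W (fun v hv => (hVV v).2 (edgeVerts_subset ((hW v).1 hv)))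
    have h3 := M.natRk_mono (Set.subset_univ (rootsIn root (W : Set α)))
    omega)
  have hdeg' : ∀ X : Finset α, (E.filter (fun e => hd e ∈ X)).card ≤ ∑ v ∈ X, m v := by
    intro X
    rw [← Set.ncard_coe_finset]
    simpa using hdeg X
  -- By (C3) the values of `m` sum to `|E|`, so the upper bound on the complement of `X` becomes a
  -- lower bound on `X`.
  have hin : ∀ X ⊆ V, ∑ v ∈ X, m v ≤ (E.filter (fun e => hd e ∈ X)).card := by
    intro X hX
    have h1 := hdeg' (V \ X)
    have h2 := Finset.sum_sdiff (f := m) hX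
    have h3 := hm V subset_rfl
    have h4 : rootsIn root (V : Set α) = Set.univ := by
      ext i; simpa [rootsIn, hVV] using hroot i
    rw [h4] at h3
    have h5 := Finset.card_filter_add_card_filter_not (s := E) (fun e => hd e ∈ X)
    have h6 : (E.filter (fun e => hd e ∉ X)).card ≤ (E.filter (fun e => hd e ∈ V \ X)).card := by
      refine Finset.card_le_card fun e he => ?_
      obtain ⟨he, heX⟩ := Finset.mem_filter.1 he
      exact Finset.mem_filter.2 ⟨he, Finset.mem_sdiff.2 ⟨(hVV _).2 (hlink e he).right_mem, heX⟩⟩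
    omega
  have hconn : ∀ X ⊆ V, X.Nonempty →
      k ≤ (enteringArcs E tl hd X).card + M.natRk (rootsIn root (X : Set α)) := by
    intro X hX hXne
    let F := E.filter (fun e => hd e ∈ X ∧ tl e ∈ X)
    have hsplit : (enteringArcs E tl hd X).card + F.card = (E.filter (fun e => hd e ∈ X)).card := by
      rw [← Finset.card_union_of_disjoint]
      · congr 1
        ext e
        simp only [F, Finset.mem_union, mem_enteringArcs, Finset.mem_filter]
        tauto
      · rw [Finset.disjoint_left]
        intro e he he'
        exact (mem_enteringArcs.1 he).2.2 (Finset.mem_filter.1 he').2.2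
    -- `W` is `V(F)` for the set `F` of arcs inside `X`. If `F` is empty, (C2) says nothing and any
    -- single vertex of `X` serves, by (C1).
    obtain ⟨W, hWX, hW⟩ : ∃ W ⊆ X, F.card + (rootsIn root (W : Set α)).ncard + k ≤
        k * W.card + M.natRk (rootsIn root (W : Set α)) := by
      rcases F.eq_empty_or_nonempty with hF | hF
      · obtain ⟨x, hx⟩ := hXne
        refine ⟨{x}, Finset.singleton_subset_iff.2 hx, ?_⟩
        have := (hind x ((hVV x).1 (hX hx))).natRk_eq_ncard
        simp only [hF, Finset.card_empty, Finset.coe_singleton, Finset.card_singleton]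
        omega
      · have hsub : G.edgeVerts F ⊆ X := by
          rintro x ⟨e, he, hi⟩
          obtain ⟨heE, h1, h2⟩ := Finset.mem_filter.1 (Finset.mem_coe.1 he)
          rcases hi.eq_or_eq_of_isLink (hlink e heE) with rfl | rfl
          exacts [h2, h1]
        obtain ⟨W, hW⟩ := (X.finite_toSet.subset hsub).exists_finset
        have hWc : (W : Set α) = G.edgeVerts F := by ext; simp [hW]
        refine ⟨W, Finset.coe_subset.1 (hWc ▸ hsub), ?_⟩
        have h1 := hsparse F (hEcoe ▸ Finset.coe_subset.2 (Finset.filter_subset _ _)) hF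
        rwa [← hWc, Set.ncard_coe_finset, Set.ncard_coe_finset] at h1
    have h1 := hin X hX
    have h2 := hm X hX
    have h3 := hm (X \ W) (Finset.sdiff_subset.trans hX)
    have h4 := hm W (hWX.trans hX)
    have h5 := Finset.sum_sdiff (f := m) hWX
    have h6 : M.natRk (rootsIn root (W : Set α)) ≤ M.natRk (rootsIn root (X : Set α)) :=
      M.natRk_mono (fun i hi => hWX hi)
    omega
  have hS : ∀ v, {i | v ∈ G.spannedVerts (∅ : Set β) (root i)} = rootsIn root {v} := by
    intro v; ext i; simp [spannedVerts, rootsIn, eq_comm]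
  refine exists_basicDecomposition_of_partial (T := fun _ => ∅) hE V hVV hroot hM hk
    (by rw [← hVcoe, ← hEcoe, Set.ncard_coe_finset, Set.ncard_coe_finset, hcard])
    tl hd E hlink (fun _ => .empty) (by simp) (by simp) (fun e he => Or.inl ((hEE e).2 he)) ?_ ?_
  · intro v hv
    rw [hS]
    exact hind v ((hVV v).1 hv)
  · intro X hX hXne
    simp only [hS]
    have : labelUnion (fun v => rootsIn root {v}) X = rootsIn root (X : Set α) := by
      ext i; simp [labelUnion, rootsIn]
    rw [this]
    exact hconn X hX hXne

namespace IsBasicDecomposition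

variable {T : ι → Set β}

theorem grown (h : G.IsBasicDecomposition root M T) (hE : E(G).Finite) (i : ι) :
    G.Grown (root i) (T i) :=
  (h.isRootedTree i).grown (hE.subset (h.isRootedTree i).subset_edgeSet)

theorem indep_rootsIn (h : G.IsBasicDecomposition root M T) {v : α} (hv : v ∈ V(G)) :
    M.Indep (rootsIn root {v}) :=
  (h.basic v hv).indep.subset fun _ hi => Or.inr (Eq.symm hi)

theorem ncard_base (h : G.IsBasicDecomposition root M T) (hM : M.E = Set.univ)
    (hk : M.natRk Set.univ = k) {v : α} (hv : v ∈ V(G)) :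
    {i | v ∈ G.spannedVerts (T i) (root i)}.ncard = k := by
  rw [← (h.basic v hv).indep.natRk_eq_ncard, (h.basic v hv).natRk_eq hM, hk]

theorem ncard_edgeSet [Finite ι] (h : G.IsBasicDecomposition root M T) (hV : V(G).Finite)
    (hE : E(G).Finite) (hM : M.E = Set.univ) (hk : M.natRk Set.univ = k) :
    E(G).ncard + (Set.univ : Set ι).ncard = k * V(G).ncard := by
  obtain ⟨V, hVV⟩ := hV.exists_finset
  have hVcoe : (V : Set α) = V(G) := by ext; simp [hVV]
  rw [← h.iUnion_eq, ncard_iUnion_grown V hVV (fun i => (h.isRootedTree i).root_mem)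
    (h.grown hE) h.edge_disjoint,
    Finset.sum_congr rfl (fun v hv => h.ncard_base hM hk ((hVV v).1 hv)), ← hVcoe,
    Set.ncard_coe_finset]
  simp [mul_comm]

/-- Let `U` index the trees meeting `W = V(F)`. Each of them has fewer edges in `F` than spanned
vertices in `W`, so `|F| + |U| ≤ k|W|`. As `U` contains `R_F` and has rank `k`, at least `k -
r(R_F)` members of `U` lie outside `R_F`. -/
theorem sparse [Finite ι] (h : G.IsBasicDecomposition root M T) (hV : V(G).Finite)
    (hE : E(G).Finite) (hM : M.E = Set.univ) (hk : M.natRk Set.univ = k) {F : Set β} (hF : F ⊆ E(G))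
    (hne : F.Nonempty) :
    F.ncard + (rootsIn root (G.edgeVerts F)).ncard + k ≤
      k * (G.edgeVerts F).ncard + M.natRk (rootsIn root (G.edgeVerts F)) := by
  classical
  have := Fintype.ofFinite ι
  obtain ⟨W, hWW⟩ := (hV.subset (edgeVerts_subset (F := F))).exists_finset
  have hWc : (W : Set α) = G.edgeVerts F := by ext; simp [hWW]
  let P : ι → Set α := fun i => G.spannedVerts (T i) (root i)
  let U : Finset ι := Finset.univ.filter (fun i => (P i ∩ W).Nonempty)
  have h1 : ∑ i, (P i ∩ W).ncard = k * W.card := by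
    rw [sum_ncard_inter_eq, Finset.sum_congr rfl
      (fun v hv => h.ncard_base hM hk (edgeVerts_subset ((hWW v).1 hv)))]
    simp [mul_comm]
  have h2 : F.ncard = ∑ i, (F ∩ T i).ncard := by
    rw [← ncard_iUnion_of_disjoint (fun i => (h.grown hE i).finite.subset Set.inter_subset_right)
      (fun i j hij => (h.edge_disjoint i j hij).mono Set.inter_subset_right Set.inter_subset_right),
      ← Set.inter_iUnion, h.iUnion_eq, Set.inter_eq_left.2 hF]
  have h3 : ∀ i, (F ∩ T i).ncard + (if (P i ∩ W).Nonempty then 1 else 0) ≤ (P i ∩ W).ncard := by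
    intro i
    have hfin : (P i ∩ W).Finite := W.finite_toSet.subset Set.inter_subset_right
    have hsub : G.edgeVerts (F ∩ T i) ⊆ P i ∩ W := Set.subset_inter
      ((edgeVerts_mono Set.inter_subset_right).trans Set.subset_union_left)
      (hWc ▸ edgeVerts_mono Set.inter_subset_left)
    rcases (F ∩ T i).eq_empty_or_nonempty with h0 | h0
    · rw [h0, Set.ncard_empty, zero_add]
      split_ifs with hn
      · exact (Set.ncard_pos hfin).2 hn
      · exact Nat.zero_le _
    · have h4 := (h.grown hE i).ncard_lt_of_subset Set.inter_subset_right h0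
      have h5 := Set.ncard_le_ncard hsub hfin
      split_ifs <;> omega
  have h4 : F.ncard + U.card ≤ k * W.card := by
    rw [← h1, h2, Finset.card_filter, ← Finset.sum_add_distrib]
    exact Finset.sum_le_sum fun i _ => h3 i
  obtain ⟨e, he⟩ := hne
  obtain ⟨x, y, hl⟩ := exists_isLink_of_mem_edgeSet (hF he)
  have hx : x ∈ W := (hWW x).2 ⟨e, he, hl.inc_left⟩
  have hRU : rootsIn root (G.edgeVerts F) ⊆ U := by
    intro i hi
    exact Finset.mem_coe.2 (Finset.mem_filter.2
      ⟨Finset.mem_univ i, root i, Or.inr rfl, (hWW _).2 hi⟩)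
  have hkU : k ≤ M.natRk (U : Set ι) := by
    rw [← hk, ← (h.basic x hl.left_mem).natRk_eq hM]
    exact M.natRk_mono fun i hi => Finset.mem_coe.2 (Finset.mem_filter.2
      ⟨Finset.mem_univ i, x, hi, hx⟩)
  have h5 := M.natRk_union_le (rootsIn root (G.edgeVerts F)) (U \ rootsIn root (G.edgeVerts F))
  rw [Set.union_sdiff_cancel hRU] at h5
  have h6 := Set.ncard_sdiff_add_ncard_of_subset hRU
  rw [Set.ncard_coe_finset] at h6
  rw [← hWc, Set.ncard_coe_finset, hWc]
  omega

end IsBasicDecomposition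

end Graph

/-- Roots form the family `root : ι → α` indexed by a finite type `ι` (a multiset of vertices), and
`M` is a matroid on the whole index set `ι`. The graph `G` is a finite multigraph. -/
theorem theorem1 {α β ι : Type*} [Finite ι]
    (G : Graph α β) (hV : V(G).Finite) (hE : E(G).Finite)
    (root : ι → α) (hroot : ∀ i, root i ∈ V(G))
    (M : Matroid ι) (hM : M.E = Set.univ) (k : ℕ) (hk : M.natRk Set.univ = k) :
    (∃ T : ι → Set β, G.IsBasicDecomposition root M T) ↔
      ((∀ v ∈ V(G), M.Indep (rootsIn root {v})) ∧
       (∀ F : Set β, F ⊆ E(G) → F.Nonempty →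
          (F.ncard : ℤ) + ((rootsIn root (G.edgeVerts F)).ncard : ℤ) ≤
            (k : ℤ) * ((G.edgeVerts F).ncard : ℤ) - (k : ℤ)
              + (M.natRk (rootsIn root (G.edgeVerts F)) : ℤ)) ∧
       (E(G).ncard + (Set.univ : Set ι).ncard = k * V(G).ncard)) := by
  constructor
  · rintro ⟨T, h⟩
    refine ⟨fun v hv => h.indep_rootsIn hv, fun F hF hne => ?_, h.ncard_edgeSet hV hE hM hk⟩
    have := h.sparse hV hE hM hk hF hne
    zify at this
    linarith
  · rintro ⟨hind, hsparse, hcard⟩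
    refine Graph.exists_basicDecomposition hV hE hroot hM hk hind (fun F hF hne => ?_) hcard
    have := hsparse F hF hne
    zify
    linarith
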